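/- A finite simple graph $\Gamma=(V,E)$ is called $T_1$ if for all adjacent vertices $u,v$ (in either order) there is a vertex $w\in V\setminus\{u,v\}$ that is adjacent to $u$ and not adjacent to $v$. Given groups $(G_v)_{v\in V}$, the graph product of $(\Gamma,G_v)$ is $F/N$, where $F$ is the free product of the groups $G_v$ and $N$ is the normal closure in $F$ of all $g^{-1}h^{-1}gh$ with $g\in G_u$, $h\in G_v$, $\{u,v\}\in E$. A group $G$ is the internal graph product of $(\Gamma,G_v)$, where the $G_v$ are subgroups of $G$, if the inclusions $G_v\hookrightarrow G$ induce an isomorphism $F/N\to G$. Theorem. Let $\Gamma=(V,E)$ and $\Gamma'=(V',E')$ be finite simple $T_1$ graphs with $V\cap V'=\emptyset$, let $G$ be a group, and let $G_v$ be a nontrivial finite subgroup of $G$ for each $v\in V\cup V'$. Suppose that $G$ is the internal graph product of $(\Gamma,(G_v)_{v\in V})$ and also of $(\Gamma',(G_{v'})_{v'\in V'})$. Then there is a graph isomorphism $\phi\colon\Gamma\to\Gamma'$ such that, for every $v\in V$, the subgroups $G_v$ and $G_{\phi(v)}$ are conjugate in $G$, i.e. $[G_v]=[G_{\phi(v)}]$,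 where $[F]$ denotes the set of all subgroups of $G$ conjugate to $F$. In particular, $(\Gamma,G_v)$ and $(\Gamma',G_{v'})$ are isomorphic graphs of groups: there is a graph isomorphism $\psi\colon\Gamma\to\Gamma'$ with $G_v\cong G_{\psi(v)}$ for all $v\in V$. -/

import Mathlib

namespace RadcliffeGraphProduct

/-- A graph is `T₁` if for every edge and every labelling `u, v` of its two ends there is a third
vertex adjacent to `u` and not adjacent to `v`. -/
def IsT1 {V : Type*} (Γ : SimpleGraph V) : Prop :=
  ∀ u v : V, Γ.Adj u v → ∃ w : V, w ≠ u ∧ w ≠ v ∧ Γ.Adj u w ∧ ¬ Γ.Adj v w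

/-- The commutators `g⁻¹h⁻¹gh`, in the free product of the vertex groups, of elements `g`, `h` of
vertex groups at adjacent vertices. -/
def edgeCommutators {V : Type*} (Γ : SimpleGraph V) (A : V → Type*) [∀ v, Group (A v)] :
    Set (Monoid.CoprodI A) :=
  {x | ∃ (u v : V) (g : A u) (h : A v), Γ.Adj u v ∧
    x = (Monoid.CoprodI.of g)⁻¹ * (Monoid.CoprodI.of h)⁻¹ *
      Monoid.CoprodI.of g * Monoid.CoprodI.of h}

/-- The graph product of the graph of groups `(Γ, A)`: the free product of the vertex groups modulo
the normal closure of the commutators of elements of adjacent vertex groups. -/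
abbrev GraphProduct {V : Type*} (Γ : SimpleGraph V) (A : V → Type*) [∀ v, Group (A v)] : Type _ :=
  Monoid.CoprodI A ⧸ Subgroup.normalClosure (edgeCommutators Γ A)

/-- The canonical homomorphism from a vertex group to the graph product. -/
def GraphProduct.of {V : Type*} (Γ : SimpleGraph V) (A : V → Type*) [∀ v, Group (A v)] (v : V) :
    A v →* GraphProduct Γ A :=
  (QuotientGroup.mk' (Subgroup.normalClosure (edgeCommutators Γ A))).comp Monoid.CoprodI.of

/-- `G` is the internal graph product of `(Γ, H)`, for a family `H` of subgroups of `G`: there is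
an isomorphism from the graph product of the groups `H v` onto `G` that is the inclusion on each
vertex group. -/
def IsInternalGraphProduct {G V : Type*} [Group G] (Γ : SimpleGraph V) (H : V → Subgroup G) :
    Prop :=
  ∃ e : GraphProduct Γ (fun v => H v) ≃* G,
    ∀ (v : V) (x : H v), e (GraphProduct.of Γ (fun v => H v) v x) = (x : G)

/-- `[F]`: the set of subgroups `gFg⁻¹` of `G` conjugate to `F`. -/
def conjClass {G : Type*} [Group G] (F : Subgroup G) : Set (Subgroup G) :=
  {K | ∃ g : G, K = F.map (MulAut.conj g).toMonoidHom}

/-- The graphs of groups `(Γ, A)` and `(Γ', B)` are isomorphic: some graph isomorphism matches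
isomorphic vertex groups. -/
def IsoGraphsOfGroups {V W : Type*} (Γ : SimpleGraph V) (A : V → Type*) [∀ v, Group (A v)]
    (Γ' : SimpleGraph W) (B : W → Type*) [∀ w, Group (B w)] : Prop :=
  ∃ φ : Γ ≃g Γ', ∀ v : V, Nonempty (A v ≃* B (φ v))

end RadcliffeGraphProduct

/-! The idea is to recover the conjugates of the vertex groups, and adjacency, from the finite
subgroups of `G` alone; two decompositions of `G` must then give the same data.

At each vertex `v`, `G` is an amalgam of the subgroup of the vertices other than `v` and the
subgroup of the star of `v` (`isAmalgam`), so it acts on a Bass–Serre tree. Finite groups fix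
vertices of this tree, whence every finite subgroup is conjugate into a clique subgroup
(`exists_isClique_conj_mem`). Consequently the maximal finite subgroups are the conjugates of the
subgroups of maximal cliques.

The same tree shows that a conjugator between elements of clique subgroups with nontrivial
`v`-component normalizes `H v` (`conj_mem_special`). So a nontrivial intersection of maximal finite
subgroups contains a conjugate of a vertex group (`conjBy_le`). By `T₁`, the maximal cliques through
`v` meet only in `v`, so conjugates of `H v` are themselves such intersections (`isFiniteMeet`). The
minimal nontrivial intersections are thus exactly the conjugates of vertex groups, and distinct
vertices are adjacent when conjugates of their groups share a finite overgroup (`adj_iff_joinable`).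
-/

namespace RadcliffeGraphProduct

open Monoid

/-! ### Distances in trees -/

section Tree

variable {T : Type*} {G : SimpleGraph T}

theorem eq_of_adj_of_dist_lt (hG : G.IsTree) {p x y z : T} (hx : G.Adj z x) (hy : G.Adj z y)
    (hdx : G.dist p z = G.dist p x + 1) (hdy : G.dist p z = G.dist p y + 1) : x = y := by
  obtain ⟨q, hq, hql⟩ := hG.connected.exists_path_of_dist p x
  obtain ⟨r, hr, hrl⟩ := hG.connected.exists_path_of_dist p y
  have h1 : (q.concat hx.symm).IsPath :=
    SimpleGraph.Walk.isPath_of_length_eq_dist _ (by simp [hql, hdx])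
  have h2 : (r.concat hy.symm).IsPath :=
    SimpleGraph.Walk.isPath_of_length_eq_dist _ (by simp [hrl, hdy])
  have := congrArg SimpleGraph.Walk.penultimate ((hG.existsUnique_path p z).unique h1 h2)
  simpa using this

/-- Only one neighbour of a vertex is nearer to `p`, so a path that starts away from `p` would have
to backtrack in order to turn towards it. -/
theorem dist_eq_add_length_of_isPath (hG : G.IsTree) {p x y z : T} (h : G.Adj x z)
    (q : G.Walk z y) (hq : (SimpleGraph.Walk.cons h q).IsPath)
    (hd : G.dist p z = G.dist p x + 1) : G.dist p y = G.dist p z + q.length := by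
  induction q generalizing x with
  | nil => rfl
  | @cons z u y h' q ih =>
    have hxu : x ≠ u := by
      rintro rfl
      simp [SimpleGraph.Walk.cons_isPath_iff] at hq
    have hu : G.dist p u = G.dist p z + 1 := by
      rcases hG.dist_eq_dist_add_one_of_adj p h' with hu | hu
      · exact absurd (eq_of_adj_of_dist_lt hG h.symm h' hd hu) hxu
      · exact hu
    rw [ih h' ((SimpleGraph.Walk.cons_isPath_iff _ _).1 hq).1 hu, hu, SimpleGraph.Walk.length_cons]
    omega

/-- Convexity of distance: the second vertex of the path from `x` to `y` works for all `p` at once,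
since a first step away from `p` forces the path to recede all the way to `y`. -/
theorem exists_forall_dist_lt_max (hG : G.IsTree) {x y : T} (hxy : x ≠ y) (hadj : ¬ G.Adj x y) :
    ∃ z, ∀ p, G.dist p z < max (G.dist p x) (G.dist p y) := by
  obtain ⟨q, hq, -⟩ := hG.existsUnique_path x y
  cases q with
  | nil => exact absurd rfl hxy
  | @cons _ z _ h q =>
    refine ⟨z, fun p => ?_⟩
    rcases hG.dist_eq_dist_add_one_of_adj p h with hz | hz
    · exact lt_max_of_lt_left (by omega)
    · have hl : q.length ≠ 0 := fun h0 => hadj (SimpleGraph.Walk.eq_of_length_eq_zero h0 ▸ h)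
      have := dist_eq_add_length_of_isPath hG h q hq hz
      exact lt_max_of_lt_right (by omega)

theorem exists_adj_dist_eq (hG : G.IsTree) {x y : T} (hxy : x ≠ y) :
    ∃ z, G.Adj x z ∧ G.dist y x = G.dist y z + 1 := by
  obtain ⟨q, hq⟩ := hG.connected.exists_walk_length_eq_dist x y
  cases q with
  | nil => exact absurd rfl hxy
  | @cons _ z _ h q =>
    refine ⟨z, h, ?_⟩
    have := SimpleGraph.dist_le q
    rw [SimpleGraph.Walk.length_cons] at hq
    rw [G.dist_comm, G.dist_comm (u := y)]
    rw [G.dist_comm (v := y)] at this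
    rcases hG.dist_eq_dist_add_one_of_adj y h with hz | hz <;>
    grind [SimpleGraph.dist_comm]

end Tree

/-! ### Groups acting on trees -/

section TreeAction

variable {T : Type*} {Γ : SimpleGraph T} {G : Type*} [Group G] [MulAction G T]

theorem dist_smul (hΓ : Γ.Connected)
    (hadj : ∀ (g : G) (x y : T), Γ.Adj x y → Γ.Adj (g • x) (g • y)) (g : G) (x y : T) :
    Γ.dist (g • x) (g • y) = Γ.dist x y := by
  have key : ∀ (g : G) (x y : T), Γ.dist (g • x) (g • y) ≤ Γ.dist x y := by
    intro g x y
    obtain ⟨p, hp⟩ := hΓ.exists_walk_length_eq_dist x y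
    let φ : Γ →g Γ := ⟨fun x => g • x, hadj g _ _⟩
    have := SimpleGraph.dist_le (p.map φ)
    rwa [SimpleGraph.Walk.length_map, hp] at this
  refine le_antisymm (key g x y) ?_
  simpa using key g⁻¹ (g • x) (g • y)

/-- The radius `f x` of a finite orbit as seen from `x` is an invariant function. At a minimum `x`,
a translate `g • x ≠ x` is not adjacent to `x`, and a vertex between the two would have smaller
radius. -/
theorem exists_forall_smul_eq_of_finite [Nonempty T] (hΓ : Γ.IsTree)
    (hadj : ∀ (g : G) (x y : T), Γ.Adj x y → Γ.Adj (g • x) (g • y))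
    (hinv : ∀ (g : G) (x : T), ¬ Γ.Adj x (g • x)) [Finite G] :
    ∃ x : T, ∀ g : G, g • x = x := by
  classical
  have := Fintype.ofFinite G
  obtain ⟨o⟩ := ‹Nonempty T›
  let f : T → ℕ := fun x => Finset.univ.sup fun g : G => Γ.dist (g • o) x
  have hf : ∀ (g : G) (x : T), f (g • x) = f x := by
    have key : ∀ (g : G) x, f (g • x) ≤ f x := by
      intro g x
      refine Finset.sup_le fun k _ => ?_
      have : Γ.dist (k • o) (g • x) = Γ.dist ((g⁻¹ * k) • o) x := by
        rw [← dist_smul hΓ.connected hadj g ((g⁻¹ * k) • o : T) x, smul_smul, mul_inv_cancel_left]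
      rw [this]
      exact Finset.le_sup (f := fun g : G => Γ.dist (g • o) x) (Finset.mem_univ _)
    intro g x
    refine le_antisymm (key g x) ?_
    simpa using key g⁻¹ (g • x)
  obtain ⟨x, hx⟩ : ∃ x, ∀ y, f x ≤ f y := by
    obtain ⟨x, hx⟩ := WellFounded.has_min (measure f).wf Set.univ ⟨o, trivial⟩
    exact ⟨x, fun y => not_lt.1 (hx.2 y trivial)⟩
  refine ⟨x, fun g => ?_⟩
  by_contra hne
  obtain ⟨z, hz⟩ := exists_forall_dist_lt_max hΓ (Ne.symm hne) (hinv g x)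
  have hle : ∀ y, f y = f x → ∀ k : G, Γ.dist (k • o) y ≤ f x := fun y hy k =>
    hy ▸ Finset.le_sup (f := fun g : G => Γ.dist (g • o) y) (Finset.mem_univ _)
  have hlt : ∀ k : G, Γ.dist (k • o) z < f x := fun k =>
    (hz _).trans_le (max_le (hle x rfl k) (hle _ (hf g x) k))
  have : f z < f x := (Finset.sup_lt_iff (lt_of_le_of_lt (Nat.zero_le _) (hlt 1))).2
    fun k _ => hlt k
  exact absurd (hx z) (not_le.2 this)

/-- The neighbour of `x` towards `y` is unique, hence fixed with them. -/
theorem exists_adj_smul_eq (hΓ : Γ.IsTree)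
    (hadj : ∀ (g : G) (x y : T), Γ.Adj x y → Γ.Adj (g • x) (g • y)) {g : G} {x y : T}
    (hxy : x ≠ y) (hx : g • x = x) (hy : g • y = y) : ∃ z, Γ.Adj x z ∧ g • z = z := by
  obtain ⟨z, hz, hd⟩ := exists_adj_dist_eq hΓ hxy
  refine ⟨z, hz, ?_⟩
  refine eq_of_adj_of_dist_lt hΓ (p := y) (z := x) ?_ hz ?_ hd
  · simpa [hx] using hadj g _ _ hz
  · rw [hd, ← dist_smul hΓ.connected hadj g y z, hy]

end TreeAction

/-! ### Amalgamated products -/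

section Amalgam

variable {G : Type*} [Group G] (F : Bool → Subgroup G)

/-- `Alternating F i g`: the element `g` is a nonempty product of letters taken alternately from
`F i \ F (!i)` and from `F (!i) \ F i`, beginning with the former. -/
inductive Alternating : Bool → G → Prop
  | single (i : Bool) (s : G) : s ∈ F i → s ∉ F (!i) → Alternating i s
  | cons (i : Bool) (s g : G) : s ∈ F i → s ∉ F (!i) → Alternating (!i) g → Alternating i (s * g)

/-- `G` is the amalgamated product of the subgroups `F true` and `F false` over their
intersection. -/
structure IsAmalgam : Prop where
  iSup_eq_top : ⨆ i, F i = ⊤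
  not_mem_of_alternating : ∀ i g, Alternating F i g → g ∉ F i ⊓ F (!i)

/-- The inclusions of the intersection of the two subgroups `F i` into them. -/
def amalgamMap (i : Bool) : (F true ⊓ F false : Subgroup G) →* F i :=
  Subgroup.inclusion (by cases i; exacts [inf_le_right, inf_le_left])

variable {F}

theorem inf_not_eq (i : Bool) : F i ⊓ F (!i) = F true ⊓ F false := by
  cases i
  · exact inf_comm _ _
  · rfl

theorem amalgamMap_injective (i : Bool) : Function.Injective (amalgamMap F i) :=
  Subgroup.inclusion_injective _

theorem not_mem_range_amalgamMap {i : Bool} {s : G} (hs : s ∈ F i) (hs' : s ∉ F (!i)) :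
    (⟨s, hs⟩ : F i) ∉ (amalgamMap F i).range := by
  rintro ⟨⟨c, hc⟩, h⟩
  have h2 : c = s := congrArg Subtype.val h
  subst h2
  rw [← inf_not_eq i] at hc
  exact hs' hc.2

theorem Alternating.exists_word (r : G →* PushoutI (amalgamMap F))
    (hr : ∀ i (x : F i), r x = PushoutI.of i x) {i : Bool} {g : G} (h : Alternating F i g) :
    ∃ w : CoprodI.Word (fun i => F i), PushoutI.Reduced (amalgamMap F) w ∧ w.fstIdx = some i ∧
      PushoutI.ofCoprodI w.prod = r g := by
  classical
  induction h with
  | single i s hs hs' =>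
    have h1 : (⟨s, hs⟩ : F i) ≠ 1 := fun h =>
      not_mem_range_amalgamMap hs hs' (h ▸ one_mem _)
    refine ⟨CoprodI.Word.cons ⟨s, hs⟩ .empty (fun h => by cases h) h1, ?_,
      by simp, ?_⟩
    · intro g hg
      simp [CoprodI.Word.cons, CoprodI.Word.empty] at hg
      subst hg
      exact not_mem_range_amalgamMap hs hs'
    · rw [CoprodI.Word.prod_cons, CoprodI.Word.prod_empty, mul_one, PushoutI.ofCoprodI_of]
      exact (hr i ⟨s, hs⟩).symm
  | cons i s g hs hs' _ ih =>
    obtain ⟨w, hw, hi, hp⟩ := ih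
    have h1 : (⟨s, hs⟩ : F i) ≠ 1 := fun h =>
      not_mem_range_amalgamMap hs hs' (h ▸ one_mem _)
    refine ⟨CoprodI.Word.cons ⟨s, hs⟩ w (by rw [hi]; simp) h1, ?_, by simp, ?_⟩
    · intro g hg
      simp only [CoprodI.Word.cons, List.mem_cons] at hg
      rcases hg with rfl | hg
      · exact not_mem_range_amalgamMap hs hs'
      · exact hw g hg
    · simp [hp, ← hr]

/-- The map `r` sends an alternating product to a nonempty reduced word of the pushout, which by the
normal form theorem lies outside the base. -/
theorem IsAmalgam.of_hom (hF : ⨆ i, F i = ⊤) (r : G →* PushoutI (amalgamMap F))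
    (hr : ∀ i (x : F i), r x = PushoutI.of i x) : IsAmalgam F := by
  refine ⟨hF, fun i g hg hmem => ?_⟩
  obtain ⟨w, hw, hi, hp⟩ := hg.exists_word r hr
  have hg' : g ∈ F true ⊓ F false := (inf_not_eq (F := F) i) ▸ hmem
  have h : PushoutI.ofCoprodI w.prod ∈ (PushoutI.base (amalgamMap F)).range := by
    refine ⟨⟨g, hg'⟩, ?_⟩
    rw [hp, ← PushoutI.of_apply_eq_base (amalgamMap F) i ⟨g, hg'⟩, ← hr]
    rfl
  have := hw.eq_empty_of_mem_range amalgamMap_injective h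
  subst this
  simp [CoprodI.Word.fstIdx, CoprodI.Word.empty] at hi

/-- Otherwise prepending the letter `g⁻¹` would write 1 as an alternating product. -/
theorem IsAmalgam.not_mem_not (hF : IsAmalgam F) {i : Bool} {g : G} (h : Alternating F i g) :
    g ∉ F (!i) := by
  intro hg
  by_cases hi : g ∈ F i
  · exact hF.2 i g h ⟨hi, hg⟩
  · have h2 : Alternating F (!i) (g⁻¹ * g) :=
      .cons _ _ _ (inv_mem hg) (by simpa using hi) (by simpa using h)
    rw [inv_mul_cancel] at h2
    exact hF.2 _ _ h2 (one_mem _)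

/-! ### The Bass–Serre tree -/

variable (F)

/-- The Bass–Serre tree of the two subgroups `F i`: the vertices are their left cosets, and two
cosets of different subgroups are adjacent when they meet. -/
def cosetGraph : SimpleGraph (Σ i : Bool, G ⧸ F i) where
  Adj x y := x.1 ≠ y.1 ∧ ∃ g : G, x.2 = (g : G ⧸ F x.1) ∧ y.2 = (g : G ⧸ F y.1)
  symm := ⟨fun _ _ ⟨h, g, h1, h2⟩ => ⟨h.symm, g, h2, h1⟩⟩
  loopless := ⟨fun _ h => h.1 rfl⟩

/-- The coset of `g` as a vertex of the Bass–Serre tree. -/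
def cosetVertex (i : Bool) (g : G) : Σ i : Bool, G ⧸ F i := ⟨i, (g : G ⧸ F i)⟩

variable {F}

theorem exists_eq_cosetVertex (x : Σ i : Bool, G ⧸ F i) : ∃ g, x = cosetVertex F x.1 g := by
  obtain ⟨i, q⟩ := x
  obtain ⟨g, rfl⟩ := QuotientGroup.mk_surjective q
  exact ⟨g, rfl⟩

theorem cosetVertex_eq_iff {i j : Bool} {g h : G} :
    cosetVertex F i g = cosetVertex F j h ↔ i = j ∧ g⁻¹ * h ∈ F i := by
  constructor
  · intro e
    have hij : i = j := congrArg Sigma.fst e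
    subst hij
    refine ⟨rfl, ?_⟩
    simpa [cosetVertex, QuotientGroup.eq] using e
  · rintro ⟨rfl, h⟩
    simpa [cosetVertex, QuotientGroup.eq] using h

theorem cosetGraph_adj {i : Bool} {g : G} {y : Σ i : Bool, G ⧸ F i}
    (h : (cosetGraph F).Adj (cosetVertex F i g) y) :
    ∃ s ∈ F i, y = cosetVertex F (!i) (g * s) := by
  obtain ⟨j, q⟩ := y
  obtain ⟨h, k, h1, h2⟩ := h
  have hj : j = !i := by
    simp only [cosetVertex] at h
    cases i <;> cases j <;> simp_all
  subst hj
  refine ⟨g⁻¹ * k, ?_, ?_⟩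
  · simpa [cosetVertex, QuotientGroup.eq] using h1
  · simp only at h2
    simp [cosetVertex, h2]

theorem cosetGraph_adj_not (i : Bool) (g : G) :
    (cosetGraph F).Adj (cosetVertex F i g) (cosetVertex F (!i) g) :=
  ⟨by simp [cosetVertex], g, rfl, rfl⟩

theorem smul_cosetVertex (i : Bool) (g h : G) :
    g • cosetVertex F i h = cosetVertex F i (g * h) := rfl

theorem cosetGraph_adj_smul (g : G) {x y : Σ i : Bool, G ⧸ F i} (h : (cosetGraph F).Adj x y) :
    (cosetGraph F).Adj (g • x) (g • y) := by
  obtain ⟨a, ha⟩ := exists_eq_cosetVertex x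
  rw [ha] at h ⊢
  obtain ⟨s, hs, rfl⟩ := cosetGraph_adj h
  have : cosetVertex F x.1 a = cosetVertex F x.1 (a * s) := by
    rw [cosetVertex_eq_iff]; simpa using hs
  rw [this, smul_cosetVertex, smul_cosetVertex]
  exact cosetGraph_adj_not _ _

/-- Translation by `g` as an endomorphism of the Bass–Serre tree. -/
def cosetGraphHom (g : G) : cosetGraph F →g cosetGraph F where
  toFun x := g • x
  map_rel' h := cosetGraph_adj_smul g h

/-- Successive edges of a walk supply letters from the two factors in turn; a letter in both factors
would be a backtrack. -/
theorem alternating_of_isPath {x x₁ y : Σ i : Bool, G ⧸ F i}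
    (h : (cosetGraph F).Adj x x₁) (q : (cosetGraph F).Walk x₁ y)
    (hp : (SimpleGraph.Walk.cons h q).IsPath) {i : Bool} {g : G} (hx : x = cosetVertex F i g)
    (hx₁ : x₁ = cosetVertex F (!i) g) :
    ∃ j w, y = cosetVertex F j (g * w) ∧ ((w = 1 ∧ j = !i) ∨ Alternating F (!i) w) := by
  induction q generalizing x i g with
  | nil => exact ⟨!i, 1, by simpa using hx₁, .inl ⟨rfl, rfl⟩⟩
  | @cons x₁ x₂ y h' q ih =>
    subst hx hx₁
    obtain ⟨t, ht, rfl⟩ := cosetGraph_adj h'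
    have hti : t ∉ F i := by
      intro hti
      have : cosetVertex F i g = cosetVertex F (!!i) (g * t) := by
        rw [cosetVertex_eq_iff]; simpa using hti
      rw [SimpleGraph.Walk.cons_isPath_iff, SimpleGraph.Walk.support_cons] at hp
      apply hp.2
      rw [this]
      exact List.mem_cons_of_mem _ q.start_mem_support
    have e : cosetVertex F (!i) g = cosetVertex F (!i) (g * t) := by
      rw [cosetVertex_eq_iff]; simpa using ht
    obtain ⟨j, w, hy, hw⟩ := ih h' ((SimpleGraph.Walk.cons_isPath_iff _ _).1 hp).1 e rfl
    refine ⟨j, t * w, by rw [hy, mul_assoc], .inr ?_⟩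
    rcases hw with ⟨rfl, -⟩ | hw
    · rw [mul_one]
      exact .single _ _ ht (by simpa using hti)
    · exact .cons _ _ _ ht (by simpa using hti) hw

theorem IsAmalgam.isAcyclic (hF : IsAmalgam F) : (cosetGraph F).IsAcyclic := by
  intro v c hc
  cases c with
  | nil => exact SimpleGraph.Walk.not_isCycle_nil hc
  | @cons _ u _ h q =>
    rw [SimpleGraph.Walk.cons_isCycle_iff] at hc
    obtain ⟨hq, he⟩ := hc
    cases q with
    | nil => exact h.ne rfl
    | @cons _ x₂ _ h' q =>
      obtain ⟨g, hg⟩ := exists_eq_cosetVertex u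
      generalize u.1 = i at hg
      subst hg
      obtain ⟨t, ht, rfl⟩ := cosetGraph_adj h'
      have e : cosetVertex F i g = cosetVertex F i (g * t) := by
        rw [cosetVertex_eq_iff]; simpa using ht
      obtain ⟨j, w, hv, hw⟩ := alternating_of_isPath h' q hq e rfl
      obtain ⟨s, hs, hv'⟩ := cosetGraph_adj (e ▸ h.symm)
      have hne : cosetVertex F (!i) (g * t) ≠ v := by
        rintro rfl
        simp [Sym2.eq_swap] at he
      rw [hv'] at hv
      obtain ⟨rfl, hsw⟩ := cosetVertex_eq_iff.1 hv
      have hsi : s ∉ F (!i) := by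
        intro hsi
        apply hne
        rw [hv', cosetVertex_eq_iff]
        refine ⟨rfl, ?_⟩
        simpa [mul_assoc] using hsi
      rcases hw with ⟨rfl, -⟩ | hw
      · exact hsi (by simpa [mul_assoc] using inv_mem hsw)
      -- The closing edge of the cycle contributes the letter `s⁻¹`, and the resulting alternating
      -- product lies in `F (!i)`.
      · have h3 : Alternating F i (s⁻¹ * w) := .cons _ _ _ (inv_mem hs) (by simpa using hsi) hw
        apply hF.not_mem_not h3
        simpa [mul_assoc] using hsw

theorem IsAmalgam.connected (hF : IsAmalgam F) : (cosetGraph F).Connected := by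
  have key : ∀ g : G, (cosetGraph F).Reachable (cosetVertex F true 1) (cosetVertex F true g) := by
    intro g
    have hg : g ∈ ⨆ i, F i := hF.1 ▸ Subgroup.mem_top g
    induction hg using Subgroup.iSup_induction' with
    | hp i x hx =>
      cases i
      · refine (cosetGraph_adj_not true 1).reachable.trans ?_
        have : cosetVertex F (!true) 1 = cosetVertex F (!true) x := by
          rw [cosetVertex_eq_iff]; simpa using hx
        rw [this]
        exact (cosetGraph_adj_not true x).symm.reachable
      · have : cosetVertex F true 1 = cosetVertex F true x := by
          rw [cosetVertex_eq_iff]; simpa using hx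
        rw [this]
    | h1 => exact .refl _
    | hmul x y hx hy ihx ihy =>
      refine ihx.trans ?_
      have := ihy.map (cosetGraphHom x)
      simpa [cosetGraphHom, smul_cosetVertex] using this
  have key2 : ∀ x, (cosetGraph F).Reachable (cosetVertex F true 1) x := by
    intro x
    obtain ⟨g, hg⟩ := exists_eq_cosetVertex x
    rw [hg]
    refine (key g).trans ?_
    cases x.1
    · exact (cosetGraph_adj_not true g).reachable
    · exact .refl _
  exact { preconnected := fun x y => (key2 x).symm.trans (key2 y)
          nonempty := ⟨cosetVertex F true 1⟩ }

theorem IsAmalgam.isTree (hF : IsAmalgam F) : (cosetGraph F).IsTree :=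
  ⟨hF.connected, hF.isAcyclic⟩

theorem IsAmalgam.exists_forall_conj_mem_of_finite (hF : IsAmalgam F) (K : Subgroup G)
    [Finite K] : ∃ i g, ∀ k ∈ K, g⁻¹ * k * g ∈ F i := by
  have : Nonempty (Σ i : Bool, G ⧸ F i) := ⟨cosetVertex F true 1⟩
  obtain ⟨x, hx⟩ := exists_forall_smul_eq_of_finite (G := K) hF.isTree
    (fun g _ _ h => cosetGraph_adj_smul (g : G) h) (fun _ _ h => h.1 rfl)
  obtain ⟨g, hg⟩ := exists_eq_cosetVertex x
  refine ⟨x.1, g, fun k hk => ?_⟩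
  have h : k • x = x := hx ⟨k, hk⟩
  generalize x.1 = i at hg
  subst hg
  rw [smul_cosetVertex, eq_comm, cosetVertex_eq_iff] at h
  simpa [mul_assoc] using h.2

/-- `x` fixes two distinct vertices, hence an edge at the first one, and edge stabilizers are
conjugates of the intersection. -/
theorem IsAmalgam.exists_conj_mem_inf (hF : IsAmalgam F) {i : Bool} {x g : G} (hx : x ∈ F i)
    (hxg : g⁻¹ * x * g ∈ F i) (hg : g ∉ F i) : ∃ h, h⁻¹ * x * h ∈ F i ⊓ F (!i) := by
  obtain ⟨z, hz, hxz⟩ := exists_adj_smul_eq (g := x) (x := cosetVertex F i 1)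
    (y := cosetVertex F i g) hF.isTree (fun g _ _ h => cosetGraph_adj_smul (g : G) h)
    (by rw [ne_eq, cosetVertex_eq_iff]; simpa using hg)
    (by rw [smul_cosetVertex, eq_comm, cosetVertex_eq_iff]; simpa using hx)
    (by rw [smul_cosetVertex, eq_comm, cosetVertex_eq_iff]; simpa [mul_assoc] using hxg)
  obtain ⟨s, hs, rfl⟩ := cosetGraph_adj hz
  rw [one_mul] at hxz
  refine ⟨s, (F i).mul_mem ((F i).mul_mem ((F i).inv_mem hs) hx) hs, ?_⟩
  rw [smul_cosetVertex, eq_comm, cosetVertex_eq_iff] at hxz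
  simpa [mul_assoc] using hxz.2

end Amalgam

/-! ### Conjugate subgroups -/

section Conj

variable {G : Type*} [Group G]

/-- The conjugate `gKg⁻¹` of a subgroup. -/
abbrev conjBy (g : G) (K : Subgroup G) : Subgroup G := K.map (MulAut.conj g).toMonoidHom

theorem mem_conjBy {g x : G} {K : Subgroup G} : x ∈ conjBy g K ↔ g⁻¹ * x * g ∈ K := by
  constructor
  · rintro ⟨k, hk, rfl⟩
    simpa [mul_assoc] using hk
  · exact fun h => ⟨_, h, by simp [mul_assoc]⟩

theorem conjBy_conjBy (g h : G) (K : Subgroup G) : conjBy g (conjBy h K) = conjBy (g * h) K := by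
  ext x
  simp [mul_assoc]

theorem conjBy_one (K : Subgroup G) : conjBy 1 K = K := by
  ext x
  simp

theorem conjBy_mono (g : G) {K L : Subgroup G} (h : K ≤ L) : conjBy g K ≤ conjBy g L :=
  Subgroup.map_mono h

/-- A subgroup is isomorphic to its conjugates. -/
noncomputable def conjByEquiv (g : G) (K : Subgroup G) : K ≃* conjBy g K :=
  K.equivMapOfInjective _ (MulAut.conj g).injective

instance finite_conjBy (g : G) (K : Subgroup G) [Finite K] : Finite (conjBy g K) :=
  Finite.of_equiv _ (conjByEquiv g K).toEquiv

end Conj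

/-! ### Graph products: universal property, special subgroups, retractions -/

section GraphProduct

variable {G V : Type*} [Group G] {Γ : SimpleGraph V} {H : V → Subgroup G}

theorem IsInternalGraphProduct.exists_hom (hG : IsInternalGraphProduct Γ H) {K : Type*} [Group K]
    (f : ∀ v, H v →* K) (hf : ∀ u v, Γ.Adj u v → ∀ g h, Commute (f u g) (f v h)) :
    ∃ F : G →* K, ∀ v (x : H v), F x = f v x := by
  obtain ⟨e, he⟩ := hG
  have hN : Subgroup.normalClosure (edgeCommutators Γ fun v => H v) ≤ (CoprodI.lift f).ker := by
    refine Subgroup.normalClosure_le_normal ?_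
    rintro _ ⟨u, v, g, h, huv, rfl⟩
    have := hf u v huv g h
    simp only [SetLike.mem_coe, MonoidHom.mem_ker, map_mul, map_inv, CoprodI.lift_of]
    rw [mul_assoc, this.eq]
    group
  refine ⟨(QuotientGroup.lift _ (CoprodI.lift f) hN).comp e.symm.toMonoidHom, fun v x => ?_⟩
  have : e.symm (x : G) = GraphProduct.of Γ (fun v => H v) v x := by
    rw [MulEquiv.symm_apply_eq, he]
  simp only [MonoidHom.comp_apply, MulEquiv.toMonoidHom_eq_coe,
    MonoidHom.coe_coe, this]
  simp [GraphProduct.of]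

theorem IsInternalGraphProduct.commute (hG : IsInternalGraphProduct Γ H) {u v : V}
    (h : Γ.Adj u v) {x y : G} (hx : x ∈ H u) (hy : y ∈ H v) : Commute x y := by
  obtain ⟨e, he⟩ := hG
  have hxy : (GraphProduct.of Γ (fun v => H v) u ⟨x, hx⟩)⁻¹ *
      (GraphProduct.of Γ (fun v => H v) v ⟨y, hy⟩)⁻¹ * GraphProduct.of Γ (fun v => H v) u ⟨x, hx⟩ *
      GraphProduct.of Γ (fun v => H v) v ⟨y, hy⟩ = 1 := by
    simp only [GraphProduct.of, MonoidHom.comp_apply, ← map_inv, ← map_mul]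
    refine (QuotientGroup.eq_one_iff _).2 (Subgroup.subset_normalClosure ?_)
    exact ⟨u, v, ⟨x, hx⟩, ⟨y, hy⟩, h, by simp⟩
  have := congrArg e hxy
  simp only [map_mul, map_inv, he, map_one] at this
  have h2 : x * y = y * x * (x⁻¹ * y⁻¹ * x * y) := by group
  rw [this, mul_one] at h2
  exact h2

theorem IsInternalGraphProduct.iSup_eq_top (hG : IsInternalGraphProduct Γ H) : ⨆ v, H v = ⊤ := by
  obtain ⟨e, he⟩ := hG
  rw [eq_top_iff]
  intro g _
  obtain ⟨q, rfl⟩ := e.surjective g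
  obtain ⟨w, rfl⟩ := QuotientGroup.mk_surjective q
  induction w using CoprodI.induction_on with
  | one => exact (map_one e) ▸ one_mem _
  | of v x => exact Subgroup.mem_iSup_of_mem v ((he v x).symm ▸ x.2)
  | mul x y hx hy =>
    rw [QuotientGroup.mk_mul, map_mul]
    exact mul_mem (hx trivial) (hy trivial)

variable (H) in
/-- The subgroup generated by the vertex groups at the vertices of a set `S`. -/
def special (S : Set V) : Subgroup G := ⨆ v ∈ S, H v

theorem le_special {S : Set V} {v : V} (hv : v ∈ S) : H v ≤ special H S :=
  le_iSup₂_of_le v hv le_rfl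

theorem special_le {S : Set V} {K : Subgroup G} : special H S ≤ K ↔ ∀ v ∈ S, H v ≤ K :=
  iSup₂_le_iff

theorem special_mono {S T : Set V} (h : S ⊆ T) : special H S ≤ special H T :=
  special_le.2 fun _ hv => le_special (h hv)

theorem special_empty : special H (∅ : Set V) = ⊥ :=
  eq_bot_iff.2 (special_le.2 fun _ h => absurd h (Set.notMem_empty _))

theorem special_singleton (v : V) : special H {v} = H v :=
  le_antisymm (special_le.2 fun _ h => by rw [Set.mem_singleton_iff.1 h]) (le_special rfl)

theorem IsInternalGraphProduct.special_univ (hG : IsInternalGraphProduct Γ H) :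
    special H Set.univ = ⊤ := by
  rw [eq_top_iff, ← hG.iSup_eq_top]
  exact iSup_le fun v => le_special trivial

theorem IsInternalGraphProduct.exists_retraction (hG : IsInternalGraphProduct Γ H) (S : Set V) :
    ∃ ρ : G →* G, (∀ v ∈ S, ∀ x ∈ H v, ρ x = x) ∧ ∀ v ∉ S, ∀ x ∈ H v, ρ x = 1 := by
  classical
  obtain ⟨ρ, hρ⟩ := hG.exists_hom (fun v => if v ∈ S then (H v).subtype else 1) (by
    intro u v huv g h
    by_cases hu : u ∈ S <;> by_cases hv : v ∈ S <;> simp only [hu, hv, if_true, if_false]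
    · exact hG.commute huv g.2 h.2
    · exact .one_right _
    · exact .one_left _
    · exact .one_left _)
  refine ⟨ρ, fun v hv x hx => ?_, fun v hv x hx => ?_⟩
  · simpa [hv] using hρ v ⟨x, hx⟩
  · simpa [hv] using hρ v ⟨x, hx⟩

/-- The retraction of a graph product onto the subgroup generated by the vertex groups of a set of
vertices that kills the other vertex groups. -/
noncomputable def IsInternalGraphProduct.retraction (hG : IsInternalGraphProduct Γ H)
    (S : Set V) : G →* G :=
  (hG.exists_retraction S).choose


theorem IsInternalGraphProduct.retraction_of_mem (hG : IsInternalGraphProduct Γ H) {S : Set V}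
    {v : V} (hv : v ∈ S) {x : G} (hx : x ∈ H v) : hG.retraction S x = x :=
  (hG.exists_retraction S).choose_spec.1 v hv x hx

theorem IsInternalGraphProduct.retraction_of_notMem (hG : IsInternalGraphProduct Γ H) {S : Set V}
    {v : V} (hv : v ∉ S) {x : G} (hx : x ∈ H v) : hG.retraction S x = 1 :=
  (hG.exists_retraction S).choose_spec.2 v hv x hx

theorem IsInternalGraphProduct.retraction_mem (hG : IsInternalGraphProduct Γ H) (S : Set V)
    {T : Set V} {x : G} (hx : x ∈ special H T) : hG.retraction S x ∈ special H (S ∩ T) := by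
  suffices h : special H T ≤ (special H (S ∩ T)).comap (hG.retraction S) from h hx
  refine special_le.2 fun v hv x hx => ?_
  rw [Subgroup.mem_comap]
  by_cases hS : v ∈ S
  · rw [hG.retraction_of_mem hS hx]
    exact le_special (S := S ∩ T) ⟨hS, hv⟩ hx
  · rw [hG.retraction_of_notMem hS hx]
    exact one_mem _

theorem IsInternalGraphProduct.retraction_eq_self (hG : IsInternalGraphProduct Γ H) {S : Set V}
    {x : G} (hx : x ∈ special H S) : hG.retraction S x = x := by
  suffices h : special H S ≤ (hG.retraction S).eqLocus (MonoidHom.id G) from h hx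
  exact special_le.2 fun v hv x hx => hG.retraction_of_mem hv hx

theorem IsInternalGraphProduct.retraction_eq_one (hG : IsInternalGraphProduct Γ H) {S T : Set V}
    (hST : S ∩ T = ∅) {x : G} (hx : x ∈ special H T) : hG.retraction S x = 1 := by
  have := hG.retraction_mem S hx
  rwa [hST, special_empty, Subgroup.mem_bot] at this

/-- The retraction onto `H v` fixes `x`, and a conjugate of `x ≠ 1` cannot be killed. -/
theorem IsInternalGraphProduct.mem_of_conj_mem (hG : IsInternalGraphProduct Γ H) {v : V}
    {S : Set V} {x g : G} (hx : x ∈ H v) (hx1 : x ≠ 1) (hg : g⁻¹ * x * g ∈ special H S) :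
    v ∈ S := by
  by_contra hv
  have h := hG.retraction_eq_one (S := {v}) (Set.singleton_inter_eq_empty.2 hv) hg
  rw [map_mul, map_mul, map_inv, hG.retraction_of_mem (Set.mem_singleton v) hx] at h
  apply hx1
  rw [mul_eq_one_iff_eq_inv, inv_mul_eq_iff_eq_mul, mul_inv_cancel] at h
  exact h

/-! ### Splitting at a vertex and its consequences -/

variable (Γ H) in
/-- The two factors of the decomposition of a graph product as an amalgamated product at the
vertex `v`: the subgroups generated by the groups of the other vertices, and by the groups of `v`
and of its neighbours. -/
def vertexFactor (v : V) (i : Bool) : Subgroup G :=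
  special H (bif i then {v}ᶜ else {u | u = v ∨ Γ.Adj v u})

/-- Both ends of every edge lie in one of the two factors, so the commutation relations hold in the
pushout and the universal property gives the map needed by `of_hom`. -/
theorem IsInternalGraphProduct.isAmalgam (hG : IsInternalGraphProduct Γ H) (v : V) :
    IsAmalgam (vertexFactor Γ H v) := by
  classical
  have hle : ∀ u, u ≠ v → H u ≤ vertexFactor Γ H v true := fun u hu =>
    le_special (S := {v}ᶜ) hu
  have hle' : ∀ u, u = v ∨ Γ.Adj v u → H u ≤ vertexFactor Γ H v false := fun u hu =>
    le_special (S := {u | u = v ∨ Γ.Adj v u}) hu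
  let ι : ∀ i, vertexFactor Γ H v i →* PushoutI (amalgamMap (vertexFactor Γ H v)) :=
    fun i => PushoutI.of (φ := amalgamMap (vertexFactor Γ H v)) i
  have hof : ∀ u (x : G) (h : x ∈ H u) (h1 : u ≠ v) (h2 : Γ.Adj v u),
      ι true ⟨x, hle u h1 h⟩ = ι false ⟨x, hle' u (.inr h2) h⟩ := by
    intro u x h h1 h2
    have hx : x ∈ vertexFactor Γ H v true ⊓ vertexFactor Γ H v false :=
      ⟨hle u h1 h, hle' u (.inr h2) h⟩
    exact (PushoutI.of_apply_eq_base (amalgamMap (vertexFactor Γ H v)) true ⟨x, hx⟩).trans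
      (PushoutI.of_apply_eq_base (amalgamMap (vertexFactor Γ H v)) false ⟨x, hx⟩).symm
  let f : ∀ u, H u →* PushoutI (amalgamMap (vertexFactor Γ H v)) := fun u =>
    if h : u = v then (ι false).comp (Subgroup.inclusion (hle' u (.inl h)))
    else (ι true).comp (Subgroup.inclusion (hle u h))
  have hfv : ∀ u (h : u = v ∨ Γ.Adj v u) (x : G) (hx : x ∈ H u),
      f u ⟨x, hx⟩ = ι false ⟨x, hle' u h hx⟩ := by
    intro u h x hx
    by_cases hu : u = v
    · simp only [f, dif_pos hu]
      rfl
    · simp only [f, dif_neg hu]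
      exact hof u x hx hu (h.resolve_left hu)
  have hft : ∀ u (h : u ≠ v) (x : G) (hx : x ∈ H u),
      f u ⟨x, hx⟩ = ι true ⟨x, hle u h hx⟩ := by
    intro u h x hx
    simp only [f, dif_neg h]
    rfl
  have hcomm : ∀ u w, Γ.Adj u w → ∀ g h, Commute (f u g) (f w h) := by
    rintro u w huw ⟨x, hx⟩ ⟨y, hy⟩
    have hxy := hG.commute huw hx hy
    by_cases hu : u = v
    · subst hu
      rw [hfv u (.inl rfl), hfv w (.inr huw)]
      exact Commute.map (Subtype.ext hxy.eq) _
    · by_cases hw : w = v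
      · subst hw
        rw [hfv u (.inr huw.symm), hfv w (.inl rfl)]
        exact Commute.map (Subtype.ext hxy.eq) _
      · rw [hft u hu, hft w hw]
        exact Commute.map (Subtype.ext hxy.eq) _
  obtain ⟨r, hr⟩ := hG.exists_hom f hcomm
  refine .of_hom ?_ r ?_
  · rw [eq_top_iff, ← hG.iSup_eq_top]
    refine iSup_le fun u => ?_
    by_cases hu : u = v
    · exact (hle' u (.inl hu)).trans (le_iSup (vertexFactor Γ H v) false)
    · exact (hle u hu).trans (le_iSup (vertexFactor Γ H v) true)
  -- The locus where `r` agrees with `ι i` is a subgroup of the factor; pushed into `G`, it can be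
  -- compared with the factor on generators.
  · have key : ∀ i, vertexFactor Γ H v i ≤ ((r.comp (vertexFactor Γ H v i).subtype).eqLocus
        (ι i)).map (vertexFactor Γ H v i).subtype := by
      intro i
      refine special_le.2 fun u hu x hx => ?_
      cases i
      · exact ⟨⟨x, hle' u hu hx⟩, (hr u ⟨x, hx⟩).trans (hfv u hu x hx), rfl⟩
      · exact ⟨⟨x, hle u hu hx⟩, (hr u ⟨x, hx⟩).trans (hft u hu x hx), rfl⟩
    rintro i ⟨x, hx⟩
    obtain ⟨y, hy, rfl⟩ := key i hx
    exact hy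

/-- Splitting at a vertex `v` of `S` not adjacent to some other `u` in `S` conjugates `K` into a
factor that omits `v` or `u`, so `S` shrinks. -/
theorem IsInternalGraphProduct.exists_isClique_conj_mem (hG : IsInternalGraphProduct Γ H)
    (S : Set V) (hS : S.Finite) (K : Subgroup G) [Finite K] (hK : K ≤ special H S) :
    ∃ g C, Γ.IsClique C ∧ ∀ k ∈ K, g⁻¹ * k * g ∈ special H C := by
  induction hn : S.ncard using Nat.strong_induction_on generalizing S K with
  | _ n ih =>
  subst hn
  by_cases hc : Γ.IsClique S
  · exact ⟨1, S, hc, fun k hk => by simpa using hK hk⟩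
  obtain ⟨v, hv, u, hu, hvu, hadj⟩ : ∃ v ∈ S, ∃ u ∈ S, v ≠ u ∧ ¬ Γ.Adj v u := by
    simpa [SimpleGraph.IsClique, Set.Pairwise] using hc
  obtain ⟨i, g, hg⟩ := (hG.isAmalgam v).exists_forall_conj_mem_of_finite K
  -- The retraction onto `S` fixes `K`, so applying it to the conjugator keeps the conjugate of `K`
  -- inside `special H S`.
  obtain ⟨T, hTS, hT⟩ : ∃ T, T ⊂ S ∧
      ∀ k ∈ K, (hG.retraction S g)⁻¹ * k * hG.retraction S g ∈ special H T := by
    refine ⟨S ∩ (bif i then {v}ᶜ else {u | u = v ∨ Γ.Adj v u}), ?_, fun k hk => ?_⟩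
    rotate_left
    · have := hG.retraction_mem S (hg k hk)
      rwa [map_mul, map_mul, map_inv, hG.retraction_eq_self (hK hk)] at this
    · refine Set.ssubset_iff_subset_ne.2 ⟨Set.inter_subset_left, fun h => ?_⟩
      rw [Set.inter_eq_left] at h
      cases i
      · rcases h hu with rfl | h
        · exact hvu rfl
        · exact hadj h
      · exact h hv rfl
  obtain ⟨g', C, hC, h⟩ := ih _ (Set.ncard_lt_ncard hTS hS) T (hS.subset hTS.subset)
    (conjBy (hG.retraction S g)⁻¹ K) (by
      rintro _ ⟨k, hk, rfl⟩
      simpa using hT k hk) rfl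
  refine ⟨hG.retraction S g * g', C, hC, fun k hk => ?_⟩
  simpa [mul_assoc] using h _ ⟨k, hk, rfl⟩

theorem IsInternalGraphProduct.conj_mem_of_mem (hG : IsInternalGraphProduct Γ H) {v : V}
    {y g : G} (hg : g ∈ special H {u | u = v ∨ Γ.Adj v u}) (hy : y ∈ H v) :
    g⁻¹ * y * g ∈ H v := by
  suffices h : special H {u | u = v ∨ Γ.Adj v u} ≤ Subgroup.normalizer (H v : Set G) by
    simpa using (Subgroup.mem_normalizer_iff.1 (inv_mem (h hg)) y).1 hy
  refine special_le.2 fun u hu => ?_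
  rcases hu with rfl | hu
  · exact Subgroup.le_normalizer
  · refine le_trans (fun x hx => ?_) (Subgroup.centralizer_le_normalizer _)
    exact Subgroup.mem_centralizer_iff.2 fun z hz => (hG.commute hu hz hx).eq

/-- Both `x` and its conjugate lie in the star factor of `v`. Were `g` outside it, `x` would be
conjugate into the subgroup of the vertices other than `v`, which the retraction onto `H v` kills.
So `g` lies in the star factor, which normalizes `H v`. -/
theorem IsInternalGraphProduct.conj_mem_special (hG : IsInternalGraphProduct Γ H) {v : V}
    {C D : Set V} (hC : Γ.IsClique C) (hD : Γ.IsClique D) {x y g : G} (hx : x ∈ special H D)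
    (hxv : hG.retraction {v} x ≠ 1) (hxg : g⁻¹ * x * g ∈ special H C) (hy : y ∈ H v) :
    g⁻¹ * y * g ∈ special H C := by
  have hvC : v ∈ C := by
    by_contra hv
    have h := hG.retraction_eq_one (S := {v}) (Set.singleton_inter_eq_empty.2 hv) hxg
    rw [map_mul, map_mul, map_inv, mul_eq_one_iff_eq_inv, inv_mul_eq_iff_eq_mul,
      mul_inv_cancel] at h
    exact hxv h
  have hvD : v ∈ D := by
    by_contra hv
    exact hxv (hG.retraction_eq_one (S := {v}) (Set.singleton_inter_eq_empty.2 hv) hx)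
  have hstar : ∀ E : Set V, Γ.IsClique E → v ∈ E →
      special H E ≤ vertexFactor Γ H v false := by
    intro E hE hv
    refine special_mono fun u hu => ?_
    by_cases huv : u = v
    · exact .inl huv
    · exact .inr (hE hv hu (Ne.symm huv))
  have hg : g ∈ vertexFactor Γ H v false := by
    by_contra hg
    obtain ⟨h, -, hh⟩ := (hG.isAmalgam v).exists_conj_mem_inf (hstar D hD hvD hx)
      (hstar C hC hvC hxg) hg
    have h1 := hG.retraction_eq_one (S := {v}) (T := {v}ᶜ) (by simp) hh
    rw [map_mul, map_mul, map_inv, mul_eq_one_iff_eq_inv, inv_mul_eq_iff_eq_mul,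
      mul_inv_cancel] at h1
    exact hxv h1
  exact le_special hvC (hG.conj_mem_of_mem hg hy)

/-- Vertex groups of a clique commute, and the retractions onto them act as coordinate projections;
hence a clique subgroup is a direct product. -/
theorem IsInternalGraphProduct.exists_pi (hG : IsInternalGraphProduct Γ H) {C : Set V}
    (hC : Γ.IsClique C) [Finite C] : ∃ F : (∀ v : C, H v) →* G, F.range = special H C ∧
      (∀ (v : C) (f : ∀ v : C, H v), hG.retraction {(v : V)} (F f) = f v) ∧
      ∀ (v : C) (f : ∀ v : C, H v), (∀ w, w ≠ v → f w = 1) → F f = f v := by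
  classical
  have := Fintype.ofFinite C
  have hcomm : Pairwise fun u v : C => ∀ x y : G, x ∈ H u → y ∈ H v → Commute x y :=
    fun u v huv x y hx hy => hG.commute (hC u.2 v.2 (Subtype.coe_injective.ne huv)) hx hy
  refine ⟨Subgroup.noncommPiCoprod hcomm, ?_, ?_, ?_⟩
  · rw [Subgroup.noncommPiCoprod_range, special, iSup_subtype']
  · intro v f
    suffices h : (hG.retraction {(v : V)}).comp (Subgroup.noncommPiCoprod hcomm) =
        (H v).subtype.comp (Pi.evalMonoidHom (fun v : C => H v) v) from DFunLike.congr_fun h f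
    refine MonoidHom.pi_ext fun w x => ?_
    simp only [MonoidHom.comp_apply, Subgroup.noncommPiCoprod_mulSingle]
    by_cases hw : w = v
    · subst hw
      simpa using hG.retraction_of_mem (Set.mem_singleton _) x.2
    · rw [hG.retraction_of_notMem (S := {(v : V)}) (v := w) (fun h => hw (Subtype.ext h)) x.2]
      simp [Pi.mulSingle_eq_of_ne (Ne.symm hw)]
  · intro v f hf
    have : f = Pi.mulSingle v (f v) := by
      funext w
      by_cases hw : w = v
      · subst hw; simp
      · rw [Pi.mulSingle_eq_of_ne hw, hf w hw]
    rw [this, Subgroup.noncommPiCoprod_mulSingle]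
    simp

theorem IsInternalGraphProduct.finite_special (hG : IsInternalGraphProduct Γ H) {C : Set V}
    (hC : Γ.IsClique C) [Finite C] (hfin : ∀ v, Finite (H v)) : Finite (special H C) := by
  obtain ⟨F, hF, -⟩ := hG.exists_pi hC
  rw [← hF]
  exact Finite.of_surjective _ F.rangeRestrict_surjective

theorem IsInternalGraphProduct.mem_of_retraction_eq_one (hG : IsInternalGraphProduct Γ H)
    {C : Set V} (hC : Γ.IsClique C) [Finite C] {x : G} (hx : x ∈ special H C) {v : V} (hv : v ∈ C)
    (h : ∀ w ∈ C, w ≠ v → hG.retraction {w} x = 1) : x ∈ H v := by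
  obtain ⟨F, hF, hF1, hF2⟩ := hG.exists_pi hC
  rw [← hF] at hx
  obtain ⟨f, rfl⟩ := hx
  rw [hF2 ⟨v, hv⟩ f]
  · exact (f ⟨v, hv⟩).2
  · intro w hw
    have := h w w.2 fun e => hw (Subtype.ext e)
    rw [hF1] at this
    exact Subtype.ext this

theorem IsInternalGraphProduct.exists_retraction_ne_one (hG : IsInternalGraphProduct Γ H)
    {C : Set V} (hC : Γ.IsClique C) [Finite C] {x : G} (hx : x ∈ special H C) (hx1 : x ≠ 1) :
    ∃ v ∈ C, hG.retraction {v} x ≠ 1 := by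
  by_contra! h
  obtain rfl | ⟨v, hv⟩ := C.eq_empty_or_nonempty
  · rw [special_empty] at hx
    exact hx1 hx
  · have := hG.mem_of_retraction_eq_one hC hx hv fun w hw _ => h w hw
    rw [← hG.retraction_of_mem (Set.mem_singleton v) this] at hx1
    exact hx1 (h v hv)

end GraphProduct

/-! ### Invariants defined by finite subgroups -/

section MaximalFinite

variable {G : Type*} [Group G]

/-- The nontrivial subgroups that are intersections of maximal finite subgroups. -/
def IsFiniteMeet (P : Subgroup G) : Prop :=
  P ≠ ⊥ ∧ ∃ 𝒮 : Set (Subgroup G), 𝒮.Nonempty ∧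
    (∀ M ∈ 𝒮, Maximal (fun K : Subgroup G => Finite K) M) ∧ P = sInf 𝒮

/-- Some conjugates of `P` and `Q` are contained in a common finite subgroup. -/
def Joinable (P Q : Subgroup G) : Prop :=
  ∃ (g h : G) (K : Subgroup G), Finite K ∧ conjBy g P ≤ K ∧ conjBy h Q ≤ K

theorem Joinable.of_conjBy {P Q : Subgroup G} {g h : G}
    (hPQ : Joinable (conjBy g P) (conjBy h Q)) : Joinable P Q := by
  obtain ⟨a, b, K, hK, h1, h2⟩ := hPQ
  rw [conjBy_conjBy] at h1 h2
  exact ⟨_, _, K, hK, h1, h2⟩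

theorem conjClass_conjBy (g : G) (K : Subgroup G) : conjClass (conjBy g K) = conjClass K := by
  ext L
  constructor
  · rintro ⟨h, rfl⟩
    exact ⟨h * g, conjBy_conjBy h g K⟩
  · rintro ⟨h, rfl⟩
    refine ⟨h * g⁻¹, ?_⟩
    change conjBy h K = conjBy (h * g⁻¹) (conjBy g K)
    rw [conjBy_conjBy, inv_mul_cancel_right]

end MaximalFinite

/-! ### Vertex groups among the finite subgroups -/

section VertexGroups

variable {G V : Type*} [Group G] {Γ : SimpleGraph V} {H : V → Subgroup G}

theorem IsInternalGraphProduct.mem_of_conjBy_le (hG : IsInternalGraphProduct Γ H)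
    (hnt : ∀ v, H v ≠ ⊥) {v : V} {S : Set V} {g h : G}
    (hle : conjBy g (H v) ≤ conjBy h (special H S)) : v ∈ S := by
  obtain ⟨x, hx, hx1⟩ := (H v).bot_or_exists_ne_one.resolve_left (hnt v)
  have := mem_conjBy.1 (hle (mem_conjBy.2 (by simpa [mul_assoc] using hx) : g * x * g⁻¹ ∈ _))
  exact hG.mem_of_conj_mem (g := g⁻¹ * h) hx hx1 (by simpa [mul_assoc] using this)

theorem IsInternalGraphProduct.eq_of_conjBy_eq (hG : IsInternalGraphProduct Γ H)
    (hnt : ∀ v, H v ≠ ⊥) {u v : V} {g h : G} (he : conjBy g (H u) = conjBy h (H v)) :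
    u = v := by
  rw [← special_singleton (H := H) v] at he
  exact Set.mem_singleton_iff.1 (hG.mem_of_conjBy_le hnt he.le)

variable [Finite V]

/-- If `w` is adjacent to `v`, the `T₁` condition supplies a neighbour `z` of `v` that bars `w` from
any clique containing it; otherwise `v` alone bars `w`. -/
theorem IsT1.exists_maximal_isClique (hT : IsT1 Γ) {v w : V} (hw : w ≠ v) :
    ∃ C, Maximal Γ.IsClique C ∧ v ∈ C ∧ w ∉ C := by
  have hext : ∀ D, Γ.IsClique D → ∃ C, D ⊆ C ∧ Maximal Γ.IsClique C := fun D hD =>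
    Finite.exists_le_maximal hD
  by_cases hadj : Γ.Adj v w
  · obtain ⟨z, -, hzw, hvz, hwz⟩ := hT v w hadj
    obtain ⟨C, hC, hm⟩ := hext {v, z} (by
      rw [SimpleGraph.isClique_pair]
      exact fun _ => hvz)
    exact ⟨C, hm, hC (by simp), fun h => hwz (hm.1 h (hC (by simp)) hzw.symm)⟩
  · obtain ⟨C, hC, hm⟩ := hext {v} (by simp)
    exact ⟨C, hm, hC rfl, fun h => hadj (hm.1 (hC rfl) h hw.symm)⟩

theorem IsInternalGraphProduct.exists_le_conjBy (hG : IsInternalGraphProduct Γ H)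
    (K : Subgroup G) [Finite K] : ∃ g C, Γ.IsClique C ∧ K ≤ conjBy g (special H C) := by
  obtain ⟨g, C, hC, h⟩ := hG.exists_isClique_conj_mem Set.univ Set.finite_univ K
    (hG.special_univ ▸ le_top)
  exact ⟨g, C, hC, fun k hk => mem_conjBy.2 (h k hk)⟩

theorem IsInternalGraphProduct.adj_iff_joinable (hG : IsInternalGraphProduct Γ H)
    (hfin : ∀ v, Finite (H v)) (hnt : ∀ v, H v ≠ ⊥) {u v : V} :
    Γ.Adj u v ↔ u ≠ v ∧ Joinable (H u) (H v) := by
  constructor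
  · intro h
    have hC : Γ.IsClique {u, v} := by
      rw [SimpleGraph.isClique_pair]
      exact fun _ => h
    refine ⟨h.ne, 1, 1, special H {u, v}, hG.finite_special hC hfin, ?_, ?_⟩ <;>
    rw [conjBy_one] <;> exact le_special (by simp)
  · rintro ⟨hne, g, h, K, hK, h1, h2⟩
    obtain ⟨k, C, hC, hKC⟩ := hG.exists_le_conjBy K
    exact hC (hG.mem_of_conjBy_le hnt (h1.trans hKC)) (hG.mem_of_conjBy_le hnt (h2.trans hKC)) hne

theorem IsInternalGraphProduct.exists_eq_conjBy (hG : IsInternalGraphProduct Γ H)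
    (hfin : ∀ v, Finite (H v)) {M : Subgroup G}
    (hM : Maximal (fun K : Subgroup G => Finite K) M) :
    ∃ g C, Γ.IsClique C ∧ M = conjBy g (special H C) := by
  have := hM.1
  obtain ⟨g, C, hC, h⟩ := hG.exists_le_conjBy M
  have := hG.finite_special hC hfin
  exact ⟨g, C, hC, hM.eq_of_le (finite_conjBy g _) h⟩

theorem IsInternalGraphProduct.maximal_finite (hG : IsInternalGraphProduct Γ H)
    (hfin : ∀ v, Finite (H v)) (hnt : ∀ v, H v ≠ ⊥) {C : Set V} (hC : Maximal Γ.IsClique C)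
    (g : G) : Maximal (fun K : Subgroup G => Finite K) (conjBy g (special H C)) := by
  have hf := hG.finite_special hC.1 hfin
  refine ⟨finite_conjBy g _, fun K hK hle => ?_⟩
  have : Finite K := hK
  obtain ⟨h, D, hD, hKD⟩ := hG.exists_le_conjBy K
  have hCD : C ⊆ D := fun v hv =>
    hG.mem_of_conjBy_le hnt (((conjBy_mono g (le_special hv)).trans hle).trans hKD)
  obtain rfl : C = D := hC.eq_of_subset hD hCD
  -- Two conjugates of one finite group, one inside the other, coincide by order.
  refine hKD.trans (Subgroup.eq_of_le_of_card_ge (hle.trans hKD) ?_).ge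
  rw [← Nat.card_congr (conjByEquiv g (special H C)).toEquiv,
    ← Nat.card_congr (conjByEquiv h (special H C)).toEquiv]

theorem IsInternalGraphProduct.isFiniteMeet (hG : IsInternalGraphProduct Γ H)
    (hfin : ∀ v, Finite (H v)) (hnt : ∀ v, H v ≠ ⊥) (hT : IsT1 Γ) (v : V) (g : G) :
    IsFiniteMeet (conjBy g (H v)) := by
  obtain ⟨C₀, hC₀, hv₀⟩ : ∃ C, Maximal Γ.IsClique C ∧ v ∈ C := by
    obtain ⟨C, hC, hm⟩ := Finite.exists_le_maximal (p := Γ.IsClique) (a := {v}) (by simp)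
    exact ⟨C, hm, hC rfl⟩
  refine ⟨fun h => hnt v ((Subgroup.map_eq_bot_iff_of_injective _
    (MulAut.conj g).injective).1 h), {M | ∃ C, Maximal Γ.IsClique C ∧ v ∈ C ∧
      M = conjBy g (special H C)}, ⟨_, C₀, hC₀, hv₀, rfl⟩, ?_, le_antisymm ?_ ?_⟩
  · rintro _ ⟨C, hC, -, rfl⟩
    exact hG.maximal_finite hfin hnt hC g
  · refine le_sInf ?_
    rintro _ ⟨C, -, hv, rfl⟩
    exact conjBy_mono g (le_special hv)
  · intro x hx
    rw [Subgroup.mem_sInf] at hx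
    rw [mem_conjBy]
    -- For each `w ≠ v`, a maximal clique through `v` avoiding `w` makes the `w`-component trivial.
    refine hG.mem_of_retraction_eq_one hC₀.1 (mem_conjBy.1 (hx _ ⟨C₀, hC₀, hv₀, rfl⟩)) hv₀
      fun w _ hw => ?_
    obtain ⟨C, hC, hvC, hwC⟩ := hT.exists_maximal_isClique hw
    exact hG.retraction_eq_one (Set.singleton_inter_eq_empty.2 hwC)
      (mem_conjBy.1 (hx _ ⟨C, hC, hvC, rfl⟩))

/-- By `conj_mem_special`, every maximal finite subgroup that contains the conjugate of `x` contains
that of all of `H v`. -/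
theorem IsInternalGraphProduct.conjBy_le (hG : IsInternalGraphProduct Γ H)
    (hfin : ∀ v, Finite (H v)) {P : Subgroup G} (hP : IsFiniteMeet P) {C : Set V}
    (hC : Γ.IsClique C) {g x : G} {v : V} (hx : x ∈ special H C)
    (hxv : hG.retraction {v} x ≠ 1) (hxP : g * x * g⁻¹ ∈ P) : conjBy g (H v) ≤ P := by
  obtain ⟨-, 𝒮, -, h𝒮, rfl⟩ := hP
  refine le_sInf fun M hM => ?_
  have hxM := Subgroup.mem_sInf.1 hxP M hM
  obtain ⟨h, D, hD, rfl⟩ := hG.exists_eq_conjBy hfin (h𝒮 M hM)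
  intro y hy
  rw [mem_conjBy] at hxM hy ⊢
  have := hG.conj_mem_special hD hC hx hxv (g := g⁻¹ * h) (by simpa [mul_assoc] using hxM) hy
  simpa [mul_assoc] using this

theorem IsInternalGraphProduct.minimal_isFiniteMeet (hG : IsInternalGraphProduct Γ H)
    (hfin : ∀ v, Finite (H v)) (hnt : ∀ v, H v ≠ ⊥) (hT : IsT1 Γ) (v : V) :
    Minimal IsFiniteMeet (H v) := by
  refine ⟨conjBy_one (H v) ▸ hG.isFiniteMeet hfin hnt hT v 1, fun Q hQ hle => ?_⟩
  obtain ⟨x, hx1⟩ := Q.ne_bot_iff_exists_ne_one.1 hQ.1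
  have h := hG.conjBy_le hfin hQ (C := {v}) (by simp) (g := 1) (x := x) (v := v)
    (by rw [special_singleton]; exact hle x.2)
    (by rw [hG.retraction_of_mem (Set.mem_singleton v) (hle x.2)]
        exact fun e => hx1 (Subtype.ext e)) (by simp)
  rwa [conjBy_one] at h

theorem IsInternalGraphProduct.exists_eq_conjBy_of_minimal (hG : IsInternalGraphProduct Γ H)
    (hfin : ∀ v, Finite (H v)) (hnt : ∀ v, H v ≠ ⊥) (hT : IsT1 Γ) {P : Subgroup G}
    (hP : Minimal IsFiniteMeet P) : ∃ v g, P = conjBy g (H v) := by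
  obtain ⟨x, hx1⟩ := P.ne_bot_iff_exists_ne_one.1 hP.1.1
  obtain ⟨-, 𝒮, ⟨M, hM⟩, h𝒮, hP𝒮⟩ := hP.1
  obtain ⟨g, C, hC, rfl⟩ := hG.exists_eq_conjBy hfin (h𝒮 M hM)
  have hxM : (x : G) ∈ conjBy g (special H C) := by
    exact Subgroup.mem_sInf.1 (hP𝒮.le x.2) _ hM
  rw [mem_conjBy] at hxM
  obtain ⟨v, -, hv⟩ := hG.exists_retraction_ne_one hC hxM (fun e => hx1 (Subtype.ext (by
    rw [mul_eq_one_iff_eq_inv, inv_mul_eq_iff_eq_mul, mul_inv_cancel] at e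
    exact e)))
  have hle := hG.conjBy_le hfin hP.1 hC (g := g) hxM hv (by simp [mul_assoc])
  exact ⟨v, g, (hP.eq_of_le (hG.isFiniteMeet hfin hnt hT v g) hle).symm⟩

end VertexGroups

/-! ### Matching the two decompositions -/

section Rigidity

variable {G V V' : Type*} [Group G] [Finite V] [Finite V'] {Γ : SimpleGraph V}
  {Γ' : SimpleGraph V'} {H : V → Subgroup G} {H' : V' → Subgroup G}

theorem exists_iso_forall_eq_conjBy (hfin : ∀ v, Finite (H v)) (hfin' : ∀ v', Finite (H' v'))
    (hnt : ∀ v, H v ≠ ⊥) (hnt' : ∀ v', H' v' ≠ ⊥) (hG : IsInternalGraphProduct Γ H)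
    (hG' : IsInternalGraphProduct Γ' H') (hT : IsT1 Γ) (hT' : IsT1 Γ') :
    ∃ φ : Γ ≃g Γ', ∀ v, ∃ g, H v = conjBy g (H' (φ v)) := by
  choose φ a hφ using fun v => hG'.exists_eq_conjBy_of_minimal hfin' hnt' hT'
    (hG.minimal_isFiniteMeet hfin hnt hT v)
  choose ψ b hψ using fun v => hG.exists_eq_conjBy_of_minimal hfin hnt hT
    (hG'.minimal_isFiniteMeet hfin' hnt' hT' v)
  have hψφ : ∀ v, ψ (φ v) = v := fun v => by
    have h := hφ v
    rw [hψ (φ v), conjBy_conjBy, ← conjBy_one (H v)] at h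
    exact (hG.eq_of_conjBy_eq hnt h).symm
  have hφψ : ∀ v, φ (ψ v) = v := fun v => by
    have h := hψ v
    rw [hφ (ψ v), conjBy_conjBy, ← conjBy_one (H' v)] at h
    exact (hG'.eq_of_conjBy_eq hnt' h).symm
  refine ⟨⟨⟨φ, ψ, hψφ, hφψ⟩, fun {u v} => ?_⟩, fun v => ⟨a v, hφ v⟩⟩
  change Γ'.Adj (φ u) (φ v) ↔ Γ.Adj u v
  rw [hG.adj_iff_joinable hfin hnt, hG'.adj_iff_joinable hfin' hnt']
  refine and_congr (Function.LeftInverse.injective hψφ).ne_iff ⟨fun h => ?_, fun h => ?_⟩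
  · rw [hψ (φ u), hψ (φ v), hψφ, hψφ] at h
    exact h.of_conjBy
  · rw [hφ u, hφ v] at h
    exact h.of_conjBy

end Rigidity

end RadcliffeGraphProduct

theorem mainTheorem3 {G V V' : Type*} [Group G] [Finite V] [Finite V']
    (Γ : SimpleGraph V) (Γ' : SimpleGraph V')
    (H : V → Subgroup G) (H' : V' → Subgroup G)
    (hfin : ∀ v, Finite (H v)) (hfin' : ∀ v', Finite (H' v'))
    (hnt : ∀ v, H v ≠ ⊥) (hnt' : ∀ v', H' v' ≠ ⊥)
    (hG : RadcliffeGraphProduct.IsInternalGraphProduct Γ H)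
    (hG' : RadcliffeGraphProduct.IsInternalGraphProduct Γ' H')
    (hT : RadcliffeGraphProduct.IsT1 Γ) (hT' : RadcliffeGraphProduct.IsT1 Γ') :
    (∃ φ : Γ ≃g Γ', ∀ v : V,
      RadcliffeGraphProduct.conjClass (H v) = RadcliffeGraphProduct.conjClass (H' (φ v))) ∧
    RadcliffeGraphProduct.IsoGraphsOfGroups Γ (fun v => H v) Γ' (fun v' => H' v') := by
  obtain ⟨φ, hφ⟩ := RadcliffeGraphProduct.exists_iso_forall_eq_conjBy hfin hfin' hnt hnt' hG hG'
    hT hT'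
  refine ⟨⟨φ, fun v => ?_⟩, φ, fun v => ?_⟩
  · obtain ⟨g, hg⟩ := hφ v
    rw [hg, RadcliffeGraphProduct.conjClass_conjBy]
  · obtain ⟨g, hg⟩ := hφ v
    exact ⟨(MulEquiv.subgroupCongr hg).trans
      (RadcliffeGraphProduct.conjByEquiv g (H' (φ v))).symm⟩
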